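/- A Jordan domain in $\mathbb C$ is a nonempty connected open set $U\subset\mathbb C$ whose boundary in the Riemann sphere $\hat{\mathbb C}$ is a Jordan curve. Let $\mathcal B_{\log}$ be the class of all functions $F:\mathcal T\to H$, with $\mathcal T,H\subset\mathbb C$, such that (the components of $\mathcal T$ being called the tracts of $F$): 1. $H$ is a $2\pi i$-periodic Jordan domain that contains a right half-plane $\{\operatorname{Re} z>R\}$; 2. every tract is an unbounded Jordan domain with real parts bounded below but unbounded from above; 3. distinct tracts have disjoint closures in $\mathbb C$, and if $(z_n)$ is a sequence of points of $\mathcal T$ all belonging to different tracts, then $z_n\to\infty$; 4. for every tract $T$, $F:T\to H$ is a conformal isomorphism; moreover $F$ extends to a continuous ($\mathbb C$-valued) function on the closure $\overline{\mathcal T}$ of $\mathcal T$ in $\mathbb C$, again denoted $F$; 5. $\exp$ is injective on every tract; 6. $\mathcal T$ is invariant under translation by $2\pi i$. For $F\in\mathcal B_{\log}$ let $J(F)$ be the set of all $z\in\overline{\mathcal T}$ such that $F^{\circ n}(z)$ is defined and lies in $\overline{\mathcal T}$ for all $n\ge 0$, and let $I(F)=\{z\in J(F): \operatorname{Re}F^{\circ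 n}(z)\to+\infty\}$ be the set of escaping points. An external address is a sequence $\underline s=T_0T_1T_2\dots$ of tracts, and $J_{\underline s}=\{z\in J(F): F^{\circ n}(z)\in\overline{T_n}\text{ for all } n\ge 0\}$. We say that $F$ satisfies a head-start condition if for every external address $\underline s=T_0T_1\dots$ there is a continuous nondecreasing function $\phi:\mathbb R\to\mathbb R$ with $\phi(x)>x$ for all $x$ such that * for all $k\ge 0$ and all $z,w\in\overline{T_k}$ with $F(z),F(w)\in\overline{T_{k+1}}$: if $\operatorname{Re}w>\phi(\operatorname{Re}z)$, then $\operatorname{Re}F(w)>\phi(\operatorname{Re}F(z))$; * for all distinct $z,w\in J_{\underline s}$ there is $M\in\mathbb N$ with $\operatorname{Re}F^{\circ M}(z)>\phi(\operatorname{Re}F^{\circ M}(w))$ or $\operatorname{Re}F^{\circ M}(w)>\phi(\operatorname{Re}F^{\circ M}(z))$. A ray tail of $F$ is an injective curve $\gamma:[0,\infty)\to I(F)$ such that $\lim_{t\to\infty}\operatorname{Re}F^{\circ n}(\gamma(t))=+\infty$ for every $n\ge0$ and such that $\operatorname{Re}F^{\circ n}(\gamma(t))\to+\infty$ uniformly in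 $t$ as $n\to\infty$. An arc in $J(F)$ connecting $a$ to $\infty$ is an injective curve $\alpha:[0,\infty)\to J(F)$ with $\alpha(0)=a$ and $\alpha(t)\to\infty$ as $t\to\infty$. **Theorem (Ray Tails).** Suppose that $F\in\mathcal B_{\log}$ satisfies a head-start condition. Then for every $z\in I(F)$ there is $k\ge 0$ such that $F^{\circ k}(z)$ is on a ray tail $\gamma$ of $F$, and this ray tail is the unique arc in $J(F)$ connecting $F^{\circ k}(z)$ to $\infty$, up to reparametrization: $\gamma$ is such an arc (with $\gamma(0)=F^{\circ k}(z)$), and every such arc $\alpha$ has the form $\alpha=\gamma\circ h$ for an increasing homeomorphism $h:[0,\infty)\to[0,\infty)$. -/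

import Mathlib

open Filter Topology Set
open scoped NNReal

namespace LogCoord

/-- A Jordan domain contained in the plane: a nonempty connected open set whose boundary in the
Riemann sphere `OnePoint ℂ` is a Jordan curve (for unbounded domains the curve passes through `∞`). -/
structure IsJordanDomain (U : Set ℂ) : Prop where
  isOpen : IsOpen U
  isConnected : IsConnected U
  exists_curve : ∃ c : Circle → OnePoint ℂ, Continuous c ∧ Function.Injective c ∧
    frontier ((fun z : ℂ => (z : OnePoint ℂ)) '' U) = range c

/-- The tracts are the connected components of the domain of definition `𝒯`. -/
def IsTract (𝒯 T : Set ℂ) : Prop :=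
  ∃ z ∈ 𝒯, T = connectedComponentIn 𝒯 z

/-- Invariance of a plane set under translation by `2πi`. -/
def IsTwoPiIPeriodic (A : Set ℂ) : Prop :=
  ∀ z : ℂ, z + 2 * (Real.pi : ℂ) * Complex.I ∈ A ↔ z ∈ A

/-- `F : 𝒯 → H` belongs to the class `B_log`. The function `F` is considered together with its
continuous extension to the closure of `𝒯` in `ℂ`; its values off that closure play no role. -/
structure IsBLog (H 𝒯 : Set ℂ) (F : ℂ → ℂ) : Prop where
  jordan_H : IsJordanDomain H
  periodic_H : IsTwoPiIPeriodic H
  halfPlane_subset : ∃ R : ℝ, {z : ℂ | R < z.re} ⊆ H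
  jordan_tract : ∀ T, IsTract 𝒯 T → IsJordanDomain T
  bddBelow_re : ∀ T, IsTract 𝒯 T → BddBelow (Complex.re '' T)
  not_bddAbove_re : ∀ T, IsTract 𝒯 T → ¬ BddAbove (Complex.re '' T)
  disjoint_closure : ∀ T T', IsTract 𝒯 T → IsTract 𝒯 T' → T ≠ T' →
    Disjoint (closure T) (closure T')
  accumulate_infty : ∀ (T : ℕ → Set ℂ) (z : ℕ → ℂ), (∀ n, IsTract 𝒯 (T n)) →
    Function.Injective T → (∀ n, z n ∈ T n) → Tendsto z atTop (cocompact ℂ)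
  conformal : ∀ T, IsTract 𝒯 T → DifferentiableOn ℂ F T ∧ BijOn F T H
  continuousOn_closure : ContinuousOn F (closure 𝒯)
  exp_injOn : ∀ T, IsTract 𝒯 T → InjOn Complex.exp T
  periodic_domain : IsTwoPiIPeriodic 𝒯

/-- The Julia set `J(F)`: all points whose whole orbit is defined and stays in `closure 𝒯`. -/
def juliaSet (𝒯 : Set ℂ) (F : ℂ → ℂ) : Set ℂ :=
  {z | ∀ n : ℕ, F^[n] z ∈ closure 𝒯}

/-- The escaping set `I(F)`. -/
def escapingSet (𝒯 : Set ℂ) (F : ℂ → ℂ) : Set ℂ :=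
  {z | z ∈ juliaSet 𝒯 F ∧ Tendsto (fun n : ℕ => (F^[n] z).re) atTop atTop}

/-- External addresses are arbitrary sequences of tracts. -/
def IsExternalAddress (𝒯 : Set ℂ) (s : ℕ → Set ℂ) : Prop :=
  ∀ n, IsTract 𝒯 (s n)

/-- The set `J_s` of points of `J(F)` with external address `s`. -/
def juliaAddress (𝒯 : Set ℂ) (F : ℂ → ℂ) (s : ℕ → Set ℂ) : Set ℂ :=
  {z | z ∈ juliaSet 𝒯 F ∧ ∀ n : ℕ, F^[n] z ∈ closure (s n)}

/-- The pair of tracts `(T, T')` satisfies the head-start condition for `φ`. -/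
def PairHeadStart (F : ℂ → ℂ) (φ : ℝ → ℝ) (T T' : Set ℂ) : Prop :=
  ∀ z ∈ closure T, ∀ w ∈ closure T, F z ∈ closure T' → F w ∈ closure T' →
    φ z.re < w.re → φ (F z).re < (F w).re

/-- The external address `s` satisfies the head-start condition for `φ`. -/
def AddressHeadStart (𝒯 : Set ℂ) (F : ℂ → ℂ) (φ : ℝ → ℝ) (s : ℕ → Set ℂ) : Prop :=
  (∀ k : ℕ, PairHeadStart F φ (s k) (s (k + 1))) ∧
  ∀ z ∈ juliaAddress 𝒯 F s, ∀ w ∈ juliaAddress 𝒯 F s, z ≠ w →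
    ∃ M : ℕ, φ (F^[M] w).re < (F^[M] z).re ∨ φ (F^[M] z).re < (F^[M] w).re

/-- `F` satisfies a head-start condition; the function `φ` may depend on the address. -/
def HeadStart (𝒯 : Set ℂ) (F : ℂ → ℂ) : Prop :=
  ∀ s : ℕ → Set ℂ, IsExternalAddress 𝒯 s →
    ∃ φ : ℝ → ℝ, Monotone φ ∧ Continuous φ ∧ (∀ x, x < φ x) ∧ AddressHeadStart 𝒯 F φ s

/-- `γ : [0,∞) → I(F)` is a ray tail of `F`. -/
structure IsRayTail (𝒯 : Set ℂ) (F : ℂ → ℂ) (γ : ℝ≥0 → ℂ) : Prop where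
  continuous : Continuous γ
  injective : Function.Injective γ
  mem_escapingSet : ∀ t, γ t ∈ escapingSet 𝒯 F
  tendsto_re : ∀ n : ℕ, Tendsto (fun t => (F^[n] (γ t)).re) atTop atTop
  uniform_escape : ∀ M : ℝ, ∃ N : ℕ, ∀ n ≥ N, ∀ t, M ≤ (F^[n] (γ t)).re

/-- `α : [0,∞) → ℂ` parametrizes an arc in `A` (together with `∞`) connecting `a` to `∞`. -/
structure IsArcToInfinity (A : Set ℂ) (a : ℂ) (α : ℝ≥0 → ℂ) : Prop where
  continuous : Continuous α
  injective : Function.Injective α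
  mem : ∀ t, α t ∈ A
  start : α 0 = a
  tendsto_infty : Tendsto α atTop (cocompact ℂ)

end LogCoord

open LogCoord

/-! Fix an address `s`. A head start of one point of `J_s` over another persists under iteration and
distinct points are eventually separated by one, so head starts order `J_s` linearly. The order is
closed, and initial segments are compact because the real part is proper on the closure of a tract.

A continuous strictly increasing function `f` on `J_s` then turns the part above `z` into a
half-line, provided that no compact relatively clopen subset of `J_s` contains `z`: a value above `f
z` omitted by `f` would cut off such a set. The functions `re ∘ F^[n]` need not be monotone for the
order, so `f` is assembled from their running suprema.

The proviso is proved dynamically. Boundary bumping in the closure of the tract `s N` yields a point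
near `F^[N] z` that cannot be cut off from infinity; pulling it back along inverse branches and
letting `N` grow gives `z` itself in the limit (`reachesInfinity_juliaAddress`).

Points above `z` are never behind `z` by a head start, hence escape uniformly. An arc in `J(F)` has
constant address, since closures of tracts are disjoint and locally finite; so it is monotone for
the order, which gives uniqueness. -/

namespace LogCoord

/-! ### The head-start order -/

/-- Real-valued functions `h n` on `X` for which the relation `∃ n, φ (h n x) < h n y` is a strict
linear order. -/
structure IsHeadStartSystem {X : Type*} (φ : ℝ → ℝ) (h : ℕ → X → ℝ) : Prop where
  lt_apply : ∀ t, t < φ t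
  step : ∀ n x y, φ (h n x) < h n y → φ (h (n + 1) x) < h (n + 1) y
  separates : ∀ x y, x ≠ y → ∃ n, φ (h n x) < h n y ∨ φ (h n y) < h n x

namespace IsHeadStartSystem

variable {X : Type*} {φ : ℝ → ℝ} {h : ℕ → X → ℝ}

theorem persist (H : IsHeadStartSystem φ h) {x y : X} {n m : ℕ} (hnm : n ≤ m)
    (hn : φ (h n x) < h n y) : φ (h m x) < h m y := by
  induction m, hnm using Nat.le_induction with
  | base => exact hn
  | succ m _ ih => exact H.step m x y ih

theorem lt_trans (H : IsHeadStartSystem φ h) {x y z : X} (hxy : ∃ n, φ (h n x) < h n y)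
    (hyz : ∃ n, φ (h n y) < h n z) : ∃ n, φ (h n x) < h n z := by
  obtain ⟨n, hn⟩ := hxy
  obtain ⟨m, hm⟩ := hyz
  refine ⟨max n m, ?_⟩
  have h1 := H.persist (le_max_left n m) hn
  have h2 := H.persist (le_max_right n m) hm
  linarith [H.lt_apply (h (max n m) y)]

theorem lt_irrefl (H : IsHeadStartSystem φ h) (x : X) : ¬ ∃ n, φ (h n x) < h n x := by
  rintro ⟨n, hn⟩
  linarith [H.lt_apply (h n x)]

/-- The linear order given by eventually having a head start. -/
@[reducible] noncomputable def linearOrder (H : IsHeadStartSystem φ h) : LinearOrder X where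
  le x y := ¬ ∃ n, φ (h n y) < h n x
  lt x y := ∃ n, φ (h n x) < h n y
  le_refl x := H.lt_irrefl x
  le_trans x y z hxy hyz hzx := by
    by_cases hne : y = z
    · subst hne; exact hxy hzx
    · obtain ⟨n, hn | hn⟩ := H.separates y z hne
      · exact hxy (H.lt_trans ⟨n, hn⟩ hzx)
      · exact hyz ⟨n, hn⟩
  lt_iff_le_not_ge x y :=
    ⟨fun hxy => ⟨fun hyx => H.lt_irrefl _ (H.lt_trans hxy hyx), fun hn => hn hxy⟩,
      fun hxy => not_not.1 hxy.2⟩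
  le_antisymm x y hxy hyx := by
    by_contra hne
    obtain ⟨n, hn | hn⟩ := H.separates x y hne
    · exact hyx ⟨n, hn⟩
    · exact hxy ⟨n, hn⟩
  le_total x y := by
    by_contra! hcon
    exact H.lt_irrefl _ (H.lt_trans hcon.1 hcon.2)
  toDecidableLE := Classical.decRel _

/-- By definition `x ≤ y` negates every strict head start of `x` over `y`, so it is an intersection
of closed conditions. -/
theorem orderClosedTopology [TopologicalSpace X] (H : IsHeadStartSystem φ h) (hφ : Continuous φ)
    (hh : ∀ n, Continuous (h n)) :
    let _ := H.linearOrder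
    OrderClosedTopology X := by
  let _ := H.linearOrder
  refine ⟨?_⟩
  have : {p : X × X | p.1 ≤ p.2} = ⋂ n, {p : X × X | h n p.1 ≤ φ (h n p.2)} := by
    ext p
    change (¬ ∃ n, φ (h n p.2) < h n p.1) ↔ _
    simp
  rw [this]
  exact isClosed_iInter fun n => isClosed_le ((hh n).comp continuous_fst)
    (hφ.comp ((hh n).comp continuous_snd))

end IsHeadStartSystem

/-! ### Half-lines in closed linear orders with compact initial segments -/

section RunningSup

variable {X : Type*} [TopologicalSpace X] [LinearOrder X] [OrderClosedTopology X]

/-- The supremum of `g` over all points up to `x`. -/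
noncomputable def runningSup (g : X → ℝ) (x : X) : ℝ := sSup (g '' Iic x)

variable {g : X → ℝ}

omit [OrderClosedTopology X] in
theorem le_runningSup (hc : ∀ x : X, IsCompact (Iic x)) (hg : Continuous g) {x y : X}
    (hyx : y ≤ x) : g y ≤ runningSup g x :=
  le_csSup ((hc x).image hg).bddAbove ⟨y, hyx, rfl⟩

omit [OrderClosedTopology X] in
theorem runningSup_mono (hc : ∀ x : X, IsCompact (Iic x)) (hg : Continuous g) :
    Monotone (runningSup g) := fun x y hxy =>
  csSup_le ⟨g x, x, le_rfl, rfl⟩ (by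
    rintro _ ⟨u, hu, rfl⟩
    exact le_runningSup hc hg (le_trans hu hxy))

/-- Upper semicontinuity is the point that needs compactness: if `g` reaches `c` anywhere, there is
a least `m` with `c ≤ g m`. It lies above `x`, and the running supremum stays below `c` on the open
set `Iio m`. -/
theorem continuous_runningSup (hc : ∀ x : X, IsCompact (Iic x)) (hg : Continuous g) :
    Continuous (runningSup g) := by
  refine continuous_iff_continuousAt.2 fun x => tendsto_order.2 ⟨fun c hcx => ?_, fun c hcx => ?_⟩
  · obtain ⟨_, ⟨y, hy, rfl⟩, hyc⟩ := exists_lt_of_lt_csSup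
      (show (g '' Iic x).Nonempty from ⟨g x, x, le_rfl, rfl⟩) hcx
    rcases eq_or_lt_of_le (show y ≤ x from hy) with rfl | hlt
    · filter_upwards [hg.continuousAt.eventually (lt_mem_nhds hyc)] with u hu
      exact lt_of_lt_of_le hu (le_runningSup hc hg le_rfl)
    · filter_upwards [Ioi_mem_nhds hlt] with u hu
      exact lt_of_lt_of_le hyc (le_runningSup hc hg hu.le)
  · have key : ∀ u, (∀ y ≤ u, g y < c) → runningSup g u < c := by
      intro u hu
      obtain ⟨y, hy, hy'⟩ := (hc u).exists_sSup_image_eq ⟨u, le_rfl⟩ hg.continuousOn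
      rw [runningSup, hy']
      exact hu y hy
    by_cases hS : ∃ b, c ≤ g b
    · obtain ⟨b, hb⟩ := hS
      obtain ⟨m, hm, hmin⟩ := ((hc b).inter_right (isClosed_le continuous_const hg :
        IsClosed {y | c ≤ g y})).exists_isLeast ⟨b, le_rfl, hb⟩
      have hxm : x < m := by
        by_contra! hmx
        exact absurd (hm.2.trans (le_runningSup hc hg hmx)) (not_le.2 hcx)
      filter_upwards [Iio_mem_nhds hxm] with u hu
      refine key u fun y hy => ?_
      by_contra! hcy
      have hyb : y ≤ b := (hy.trans hu.le).trans hm.1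
      exact absurd (hmin ⟨hyb, hcy⟩) (not_le.2 (lt_of_le_of_lt hy hu))
    · push Not at hS
      exact Eventually.of_forall fun u => key u fun y _ => hS y

/-- A strictly increasing continuous function built from a separating sequence of continuous
functions. -/
theorem exists_strictMono_continuous (hc : ∀ x : X, IsCompact (Iic x)) (h : ℕ → X → ℝ)
    (hh : ∀ n, Continuous (h n))
    (hsep : ∀ x y, x < y → ∃ n, runningSup (h n) x < runningSup (h n) y) :
    ∃ f : X → ℝ, Continuous f ∧ StrictMono f ∧ ∀ x, h 0 x ≤ f x := by
  set a : ℕ → X → ℝ := fun n x =>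
    (1 / 2 : ℝ) ^ n * (Real.arctan (runningSup (h n) x) + Real.pi / 2) with ha
  have ha0 : ∀ n x, 0 ≤ a n x := fun n x =>
    mul_nonneg (by positivity) (by linarith [Real.neg_pi_div_two_lt_arctan (runningSup (h n) x)])
  have hab : ∀ n x, a n x ≤ (1 / 2 : ℝ) ^ n * Real.pi := fun n x =>
    mul_le_mul_of_nonneg_left
      (by linarith [Real.arctan_lt_pi_div_two (runningSup (h n) x)]) (by positivity)
  have hsum : Summable fun n : ℕ => (1 / 2 : ℝ) ^ n * Real.pi :=
    summable_geometric_two.mul_right _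
  have hsa : ∀ x, Summable fun n => a n x := fun x =>
    Summable.of_nonneg_of_le (fun n => ha0 n x) (fun n => hab n x) hsum
  have hmono : ∀ n, Monotone (a n) := fun n x y hxy =>
    mul_le_mul_of_nonneg_left (by
      have := Real.arctan_strictMono.monotone (runningSup_mono hc (hh n) hxy)
      linarith) (by positivity)
  -- The first summand dominates `h 0`, so sublevel sets of the sum inherit properness; the series,
  -- convergent thanks to `arctan`, supplies strictness.
  refine ⟨fun x => runningSup (h 0) x + ∑' n, a n x, ?_, ?_, ?_⟩
  · refine (continuous_runningSup hc (hh 0)).add (continuous_tsum (fun n => ?_) hsum fun n x => ?_)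
    · exact continuous_const.mul ((Real.continuous_arctan.comp
        (continuous_runningSup hc (hh n))).add continuous_const)
    · rw [Real.norm_of_nonneg (ha0 n x)]
      exact hab n x
  · intro x y hxy
    obtain ⟨n, hn⟩ := hsep x y hxy
    refine add_lt_add_of_le_of_lt (runningSup_mono hc (hh 0) hxy.le) ?_
    refine (hsa x).tsum_lt_tsum (fun m => hmono m hxy.le) (i := n) ?_ (hsa y)
    exact mul_lt_mul_of_pos_left (by linarith [Real.arctan_strictMono hn]) (by positivity)
  · intro x
    have : 0 ≤ ∑' n, a n x := tsum_nonneg fun n => ha0 n x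
    linarith [le_runningSup hc (hh 0) (le_refl x)]

/-- If no compact clopen set contains `z`, the points above `z` form a topological half-line. -/
theorem exists_strictMono_range_eq_Ici (h : ℕ → X → ℝ) (hc : ∀ x : X, IsCompact (Iic x))
    (hh : ∀ n, Continuous (h n))
    (hsep : ∀ x y, x < y → ∃ n, runningSup (h n) x < runningSup (h n) y)
    (hproper : ∀ (D : Set X) (c : ℝ), IsClosed D → (∀ x ∈ D, h 0 x ≤ c) → IsCompact D) {z : X}
    (hz : ∀ D : Set X, IsClopen D → IsCompact D → z ∉ D) :
    ∃ γ : ℝ≥0 → X, Continuous γ ∧ StrictMono γ ∧ γ 0 = z ∧ range γ = Ici z := by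
  obtain ⟨f, hfc, hfm, hf0⟩ := exists_strictMono_continuous hc h hh hsep
  have hsurj : ∀ t : ℝ, f z ≤ t → ∃ x, f x = t := by
    -- An omitted value `t` makes `{f < t}` clopen, and it is compact by `hproper`; but it contains
    -- `z`.
    intro t ht
    by_contra! hne
    have heq : f ⁻¹' Iio t = f ⁻¹' Iic t := by
      ext x
      exact ⟨fun hx => (show f x < t from hx).le, fun hx => lt_of_le_of_ne hx (hne x)⟩
    have hclosed : IsClosed (f ⁻¹' Iio t) := heq ▸ isClosed_Iic.preimage hfc
    exact hz (f ⁻¹' Iio t) ⟨hclosed, isOpen_Iio.preimage hfc⟩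
      (hproper _ t hclosed fun x hx => (hf0 x).trans (le_of_lt hx)) (lt_of_le_of_ne ht (hne z))
  have : Nonempty X := ⟨z⟩
  choose! u hu using hsurj
  have hu' : ∀ t : ℝ≥0, f (u (f z + t)) = f z + t := fun t => hu _ (by simp)
  have hmono : StrictMono fun t : ℝ≥0 => u (f z + t) := by
    intro s t hst
    rw [← hfm.lt_iff_lt, hu', hu']
    simpa using hst
  refine ⟨fun t => u (f z + t), ?_, hmono, hfm.injective (by rw [hu']; simp), ?_⟩
  · refine continuous_iff_continuousAt.2 fun t => ?_
    have hK : IsCompact (Iic (u (f z + (t + 1 : ℝ≥0)))) := hc _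
    -- Near `t` the curve stays in a compact initial segment, and `f` determines its only possible
    -- cluster point.
    refine hK.tendsto_nhds_of_unique_mapClusterPt ?_ fun y _ hy => ?_
    · filter_upwards [gt_mem_nhds (show t < t + 1 by simp)] with s hs
      exact (hmono hs).le
    · have h1 : MapClusterPt (f y) (𝓝 t) fun s : ℝ≥0 => f (u (f z + s)) :=
        hy.continuousAt_comp hfc.continuousAt
      have h2 : Tendsto (fun s : ℝ≥0 => f (u (f z + s))) (𝓝 t) (𝓝 (f z + t)) := by
        simp only [hu']
        exact (continuous_const.add NNReal.continuous_coe).tendsto t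
      apply hfm.injective
      rw [hu']
      exact eq_of_nhds_neBot (h1.clusterPt.mono h2)
  · ext x
    constructor
    · rintro ⟨t, rfl⟩
      rw [mem_Ici, ← hfm.le_iff_le, hu']
      simp
    · intro hx
      have hle : 0 ≤ f x - f z := sub_nonneg.2 (hfm.monotone hx)
      refine ⟨⟨f x - f z, hle⟩, hfm.injective ((hu' ⟨_, hle⟩).trans ?_)⟩
      exact add_sub_cancel (f z) (f x)

/-- A proper injective curve starting at the initial point of a half-line in an ordered space is a
reparametrization of it. -/
theorem exists_orderIso_of_injective {γ α : ℝ≥0 → X} (hγm : StrictMono γ)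
    (hγr : range γ = Ici (γ 0)) (hαc : Continuous α) (hαi : Function.Injective α)
    (hα0 : α 0 = γ 0) (hα : ∀ t, ∃ s, γ t < α s) : ∃ e : ℝ≥0 ≃o ℝ≥0, α = γ ∘ e := by
  have hαm : StrictMono α := by
    refine (hαc.strictMono_of_inj hαi).resolve_right fun hanti => ?_
    obtain ⟨s, hs⟩ := hα 0
    exact absurd (hanti.antitone zero_le) (not_le.2 (hα0 ▸ hs))
  have hαr : range α = Ici (γ 0) := by
    refine Subset.antisymm ?_ fun x hx => ?_
    · rintro _ ⟨t, rfl⟩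
      exact hα0 ▸ hαm.monotone zero_le
    · obtain ⟨t, rfl⟩ := hγr.symm ▸ hx
      obtain ⟨s, hs⟩ := hα t
      exact (isPreconnected_range hαc).Icc_subset ⟨0, rfl⟩ ⟨s, rfl⟩ ⟨hα0 ▸ hx, hs.le⟩
  refine ⟨(hαm.orderIso α).trans ((OrderIso.setCongr _ _ (hαr.trans hγr.symm)).trans
    (hγm.orderIso γ).symm), ?_⟩
  ext t
  have := congrArg Subtype.val ((hγm.orderIso γ).apply_symm_apply
    ((OrderIso.setCongr _ _ (hαr.trans hγr.symm)) (hαm.orderIso α t)))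
  exact this.symm

end RunningSup

end LogCoord

/-! ### Quasi-components reaching infinity -/

namespace LogCoord

/-- The quasi-component of `w` in the closed plane set `S` reaches `∞`: no compact relatively
clopen subset of `S` contains `w`. -/
def ReachesInfinity (S : Set ℂ) (w : ℂ) : Prop :=
  w ∈ S ∧ ∀ D ⊆ S, IsCompact D → IsClosed (S \ D) → w ∉ D

theorem ReachesInfinity.mono {S S' : Set ℂ} {w : ℂ} (h : ReachesInfinity S w) (hS : IsClosed S)
    (hSS' : S ⊆ S') : ReachesInfinity S' w := by
  refine ⟨hSS' h.1, fun D _ hD hDc hw => ?_⟩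
  refine h.2 (D ∩ S) inter_subset_right (hD.inter_right hS) ?_ ⟨hw, h.1⟩
  have : S \ (D ∩ S) = S ∩ (S' \ D) := by
    ext u
    constructor
    · rintro ⟨hu, hn⟩
      exact ⟨hu, hSS' hu, fun hD => hn ⟨hD, hu⟩⟩
    · rintro ⟨hu, _, hn⟩
      exact ⟨hu, fun hD => hn hD.1⟩
  exact this ▸ hS.inter hDc

/-- Boundary bumping at a vertical line. -/
theorem exists_reachesInfinity {C : Set ℂ} (hC : IsPreconnected C) (hCc : IsClosed C) {p : ℂ}
    (hp : p ∈ C) {x : ℝ} (hpx : p.re ≤ x) (hcomp : IsCompact (C ∩ {u | u.re ≤ x}))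
    (hnc : ¬ IsCompact C) :
    ∃ w : ℂ, w.re = x ∧ ReachesInfinity (C ∩ {u | x ≤ u.re}) w := by
  by_contra! hcon
  set S := C ∩ {u : ℂ | x ≤ u.re} with hS
  have hSc : IsClosed S := hCc.inter (isClosed_le continuous_const Complex.continuous_re)
  have hL : IsCompact (C ∩ {u : ℂ | u.re = x}) := by
    refine hcomp.of_isClosed_subset
      (hCc.inter (isClosed_eq Complex.continuous_re continuous_const)) ?_
    exact fun u hu => ⟨hu.1, le_of_eq hu.2⟩
  have hD : ∀ w, w ∈ C ∩ {u : ℂ | u.re = x} →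
      ∃ D ⊆ S, IsCompact D ∧ IsClosed (S \ D) ∧ w ∈ D := by
    intro w hw
    by_contra! hno
    exact hcon w hw.2 ⟨⟨hw.1, ge_of_eq hw.2⟩, hno⟩
  choose! D hDS hDc hDcl hwD using hD
  -- Finitely many of the pieces `D w` cover the slice `re = x`; `E` is their union. The part of `C`
  -- left of the line together with `E`, and `S \ E`, are closed and could meet only on the slice,
  -- which lies in `E`. Connectedness then leaves `S \ E` empty and `C` compact.
  obtain ⟨t, htL, ht⟩ := hL.elim_nhds_subcover (fun w => (S \ D w)ᶜ) fun w hw =>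
    (hDcl w hw).isOpen_compl.mem_nhds fun h => h.2 (hwD w hw)
  set E := ⋃ w ∈ t, D w with hE
  have hEc : IsCompact E := t.isCompact_biUnion fun w hw => hDc w (htL w hw)
  have hB : IsClosed (S \ E) := by
    have : S \ E = S ∩ ⋂ w ∈ t, S \ D w := by
      ext u
      constructor
      · rintro ⟨hu, hn⟩
        exact ⟨hu, mem_iInter₂.2 fun w hw => ⟨hu, fun h => hn (mem_iUnion₂.2 ⟨w, hw, h⟩)⟩⟩
      · rintro ⟨hu, hn⟩
        refine ⟨hu, fun h => ?_⟩
        obtain ⟨w, hw, huw⟩ := mem_iUnion₂.1 h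
        exact (mem_iInter₂.1 hn w hw).2 huw
    rw [this]
    exact hSc.inter (isClosed_biInter fun w hw => hDcl w (htL w hw))
  have hAc : IsCompact (C ∩ {u | u.re ≤ x} ∪ E) := hcomp.union hEc
  have hcov : C ⊆ (C ∩ {u | u.re ≤ x} ∪ E) ∪ S \ E := by
    intro u hu
    by_cases huE : u ∈ E
    · exact Or.inl (Or.inr huE)
    · rcases le_total u.re x with h | h
      · exact Or.inl (Or.inl ⟨hu, h⟩)
      · exact Or.inr ⟨⟨hu, h⟩, huE⟩
  by_cases hne : (C ∩ (S \ E)).Nonempty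
  · obtain ⟨u, huC, huA, huS, huE⟩ := isPreconnected_closed_iff.1 hC _ _ hAc.isClosed hB hcov
      ⟨p, hp, Or.inl ⟨hp, hpx⟩⟩ hne
    rcases huA with huA | huA
    · have hux : u ∈ C ∩ {u : ℂ | u.re = x} := ⟨huC, le_antisymm huA.2 huS.2⟩
      obtain ⟨w, hw, huw⟩ := mem_iUnion₂.1 (ht hux)
      exact huE (mem_iUnion₂.2 ⟨w, hw, by_contra fun hn => huw ⟨huS, hn⟩⟩)
    · exact huE huA
  · refine hnc (hAc.of_isClosed_subset hCc fun u hu => ?_)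
    exact (hcov hu).resolve_right fun h => hne ⟨u, hu, h⟩

/-- A compact clopen piece of the intersection has an open neighbourhood `V` with compact closure
whose frontier misses the intersection. By compactness the frontier already misses some `K n`, so
`V` cuts off a compact clopen piece of each later `K m`, one of which contains `w m`. -/
theorem ReachesInfinity.iInter {K : ℕ → Set ℂ} (hK : Antitone K) (hKc : ∀ n, IsClosed (K n))
    {w : ℕ → ℂ} (hw : ∀ n, ReachesInfinity (K n) (w n)) {z : ℂ} (hz : MapClusterPt z atTop w) :
    ReachesInfinity (⋂ n, K n) z := by
  refine ⟨mem_iInter.2 fun n => ?_, fun D hDS hD hDc hzD => ?_⟩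
  · by_contra hzn
    obtain ⟨m, hm, hnm⟩ := ((hz.frequently ((hKc n).isOpen_compl.mem_nhds hzn)).and_eventually
      (eventually_ge_atTop n)).exists
    exact hm (hK hnm (hw m).1)
  · obtain ⟨V, hVo, hDV, hVU, hVc⟩ := exists_open_between_and_isCompact_closure hD
      hDc.isOpen_compl fun u hu h => h.2 hu
    have hfr : frontier V ∩ ⋂ n, K n = ∅ := by
      refine eq_empty_of_forall_notMem fun u hu => ?_
      have h1 : u ∈ D := by_contra fun h => hVU (frontier_subset_closure hu.1) ⟨hu.2, h⟩
      have h2 := hu.1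
      rw [hVo.frontier_eq] at h2
      exact h2.2 (hDV h1)
    obtain ⟨n, hn⟩ := (hVc.of_isClosed_subset isClosed_frontier
      frontier_subset_closure).elim_directed_family_closed K hKc hfr
        (directed_of_isDirected_le fun i j hij => hK hij)
    obtain ⟨m, hm, hnm⟩ := ((hz.frequently (hVo.mem_nhds (hDV hzD))).and_eventually
      (eventually_ge_atTop n)).exists
    refine (hw m).2 (K m ∩ closure V) inter_subset_left (hVc.inter_left (hKc m)) ?_
      ⟨(hw m).1, subset_closure hm⟩
    have : K m \ (K m ∩ closure V) = K m ∩ Vᶜ := by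
      ext u
      constructor
      · rintro ⟨hu, hn⟩
        exact ⟨hu, fun hV => hn ⟨hu, subset_closure hV⟩⟩
      · rintro ⟨hu, hV⟩
        refine ⟨hu, fun hc => ?_⟩
        have : u ∈ frontier V ∩ K n := ⟨by rw [hVo.frontier_eq]; exact ⟨hc.2, hV⟩, hK hnm hu⟩
        simp [hn] at this
    rw [this]
    exact (hKc m).inter hVo.isClosed_compl

/-- `F` and `G` are inverse homeomorphisms between `S'` and `S`, so compact clopen pieces
correspond. -/
theorem ReachesInfinity.of_image {F G : ℂ → ℂ} {S S' : Set ℂ} {w : ℂ}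
    (hw : ReachesInfinity S (F w)) (hwS : w ∈ S') (hS : IsClosed S) (hF : ContinuousOn F S')
    (hmaps : MapsTo F S' S) (hinj : InjOn F S') (hG : ContinuousOn G S) (hGm : MapsTo G S S')
    (hFG : ∀ y ∈ S, F (G y) = y) : ReachesInfinity S' w := by
  refine ⟨hwS, fun D hDS hD hDc hwD => ?_⟩
  refine hw.2 (F '' D) ((image_mono hDS).trans hmaps.image_subset)
    (hD.image_of_continuousOn (hF.mono hDS)) ?_ ⟨w, hwD, rfl⟩
  have : S \ F '' D = S ∩ G ⁻¹' (S' \ D) := by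
    ext y
    constructor
    · rintro ⟨hy, hn⟩
      exact ⟨hy, hGm hy, fun h => hn ⟨G y, h, hFG y hy⟩⟩
    · rintro ⟨hy, hn⟩
      refine ⟨hy, ?_⟩
      rintro ⟨u, hu, rfl⟩
      have : G (F u) = u := hinj (hGm hy) (hDS hu) (hFG _ hy)
      exact hn.2 (this.symm ▸ hu)
  rw [this]
  exact hG.preimage_isClosed_of_isClosed hS hDc

end LogCoord

/-! ### Geometry of tracts and inverse branches -/

namespace LogCoord

variable {H 𝒯 T T' : Set ℂ} {F : ℂ → ℂ}

theorem IsTract.subset (hT : IsTract 𝒯 T) : T ⊆ 𝒯 := by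
  obtain ⟨z, -, rfl⟩ := hT
  exact connectedComponentIn_subset 𝒯 z

theorem IsTract.closure_subset (hT : IsTract 𝒯 T) : closure T ⊆ closure 𝒯 :=
  closure_mono hT.subset

theorem IsTwoPiIPeriodic.add_int_mul (h : IsTwoPiIPeriodic 𝒯) (m : ℤ) (z : ℂ) :
    z + m * (2 * Real.pi * Complex.I) ∈ 𝒯 ↔ z ∈ 𝒯 := by
  induction m with
  | zero => simp
  | succ n ih =>
    rw [← ih, ← h (z + (n : ℤ) * (2 * Real.pi * Complex.I))]
    push_cast
    ring_nf
  | pred n ih =>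
    rw [← ih, ← h (z + ((-(n : ℤ) - 1 : ℤ) : ℂ) * (2 * Real.pi * Complex.I))]
    push_cast
    ring_nf

theorem IsTract.translate (h : IsTwoPiIPeriodic 𝒯) (hT : IsTract 𝒯 T) (m : ℤ) :
    IsTract 𝒯 ((fun z => z + m * (2 * Real.pi * Complex.I)) '' T) := by
  obtain ⟨z, hz, rfl⟩ := hT
  refine ⟨z + m * (2 * Real.pi * Complex.I), (h.add_int_mul m z).2 hz, ?_⟩
  have hh := (Homeomorph.addRight ((m : ℂ) * (2 * Real.pi * Complex.I))).image_connectedComponentIn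
    (s := 𝒯) hz
  have himg : (Homeomorph.addRight ((m : ℂ) * (2 * Real.pi * Complex.I))) '' 𝒯 = 𝒯 := by
    ext u
    constructor
    · rintro ⟨v, hv, rfl⟩
      exact (h.add_int_mul m v).2 hv
    · intro hu
      refine ⟨u - m * (2 * Real.pi * Complex.I), (h.add_int_mul m _).1 ?_, ?_⟩
      · simpa using hu
      · simp
  rw [himg] at hh
  exact hh

namespace IsBLog

variable (hF : IsBLog H 𝒯 F)
include hF

theorem finite_tracts {B : Set ℂ} (hB : Bornology.IsBounded B) :
    {T | IsTract 𝒯 T ∧ (T ∩ B).Nonempty}.Finite := by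
  by_contra hinf
  set e := Set.Infinite.natEmbedding _ hinf with he
  choose z hz using fun n => (e n).2.2
  have hlim := hF.accumulate_infty (fun n => (e n : Set ℂ)) z (fun n => (e n).2.1)
    (Subtype.val_injective.comp e.injective) fun n => (hz n).1
  obtain ⟨n, hn⟩ := (hlim.eventually hB.isCompact_closure.compl_mem_cocompact).exists
  exact hn (subset_closure (hz n).2)

/-- Each horizontal strip of height `2π` met by this part of `T` gives a translate of `T` meeting
one fixed rectangle. Injectivity of `exp` makes these translates distinct tracts, so only finitely
many strips occur. -/
theorem isBounded_tract_inter (hT : IsTract 𝒯 T) (a : ℝ) :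
    Bornology.IsBounded (T ∩ {u | u.re ≤ a}) := by
  obtain ⟨b, hb⟩ := hF.bddBelow_re T hT
  set M : Set ℤ := {m | ∃ u ∈ T, u.re ≤ a ∧ 2 * Real.pi * m ≤ u.im ∧ u.im ≤ 2 * Real.pi * (m + 1)}
    with hMdef
  have hM : M.Finite := by
    refine Set.Finite.of_injOn
      (f := fun m : ℤ => (fun z : ℂ => z + (-m : ℤ) * (2 * Real.pi * Complex.I)) '' T)
      (t := {T | IsTract 𝒯 T ∧ (T ∩ (Icc b a ×ℂ Icc 0 (2 * Real.pi))).Nonempty}) ?_ ?_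
      (hF.finite_tracts ((Metric.isBounded_Icc b a).reProdIm (Metric.isBounded_Icc _ _)))
    · rintro m ⟨u, hu, hua, h1, h2⟩
      refine ⟨hT.translate hF.periodic_domain _, _, ⟨u, hu, rfl⟩, ?_⟩
      rw [Complex.mem_reProdIm]
      have hre : (u + (-m : ℤ) * (2 * Real.pi * Complex.I)).re = u.re := by simp
      have him : (u + (-m : ℤ) * (2 * Real.pi * Complex.I)).im = u.im - 2 * Real.pi * m := by
        simp
        ring
      rw [hre, him]
      refine ⟨⟨hb ⟨u, hu, rfl⟩, hua⟩, ?_, ?_⟩ <;> linarith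
    · rintro m ⟨u, hu, -⟩ n - hmn
      have hmem : u + (-m : ℤ) * (2 * Real.pi * Complex.I) ∈
          (fun z : ℂ => z + (-n : ℤ) * (2 * Real.pi * Complex.I)) '' T := by
        have : u + (-m : ℤ) * (2 * Real.pi * Complex.I) ∈
          (fun z : ℂ => z + (-m : ℤ) * (2 * Real.pi * Complex.I)) '' T := ⟨u, hu, rfl⟩
        exact hmn.subset this
      obtain ⟨v, hv, hvu⟩ := hmem
      have huv : v = u + ((n - m : ℤ) : ℂ) * (2 * Real.pi * Complex.I) := by
        have hvu' : v + (-n : ℤ) * (2 * Real.pi * Complex.I) =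
          u + (-m : ℤ) * (2 * Real.pi * Complex.I) := hvu
        push_cast at hvu' ⊢
        linear_combination hvu'
      have hvu' : v = u := hF.exp_injOn T hT hv hu
        (Complex.exp_eq_exp_iff_exists_int.2 ⟨n - m, huv⟩)
      rw [hvu'] at huv
      have h0 : ((n - m : ℤ) : ℂ) * (2 * Real.pi * Complex.I) = 0 := by
        linear_combination -huv
      have h1 : (n - m : ℤ) = 0 := by
        exact_mod_cast (mul_eq_zero.1 h0).resolve_right Complex.two_pi_I_ne_zero
      omega
  refine Bornology.IsBounded.subset ((Bornology.isBounded_biUnion hM).2 fun m _ =>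
    (Metric.isBounded_Icc b a).reProdIm
      (Metric.isBounded_Icc (2 * Real.pi * m) (2 * Real.pi * (m + 1)))) fun u hu => ?_
  have hpi : (0 : ℝ) < 2 * Real.pi := by positivity
  have h1 : 2 * Real.pi * ⌊u.im / (2 * Real.pi)⌋ ≤ u.im := by
    have := Int.floor_le (u.im / (2 * Real.pi))
    rw [le_div_iff₀ hpi] at this
    linarith
  have h2 : u.im ≤ 2 * Real.pi * (⌊u.im / (2 * Real.pi)⌋ + 1) := by
    have := (Int.lt_floor_add_one (u.im / (2 * Real.pi))).le
    rw [div_le_iff₀ hpi] at this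
    linarith
  exact mem_iUnion₂.2 ⟨⌊u.im / (2 * Real.pi)⌋, ⟨u, hu.1, hu.2, h1, h2⟩,
    Complex.mem_reProdIm.2 ⟨⟨hb ⟨u, hu.1, rfl⟩, hu.2⟩, h1, h2⟩⟩

theorem isCompact_closure_tract_inter (hT : IsTract 𝒯 T) (a : ℝ) :
    IsCompact (closure T ∩ {u | u.re ≤ a}) := by
  refine Metric.isCompact_of_isClosed_isBounded
    (isClosed_closure.inter (isClosed_le Complex.continuous_re continuous_const)) ?_
  refine (hF.isBounded_tract_inter hT (a + 1)).closure.subset ?_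
  rintro u ⟨hu, hua⟩
  have ho : IsOpen {u : ℂ | u.re < a + 1} := isOpen_lt Complex.continuous_re continuous_const
  have hlt : u.re < a + 1 := lt_of_le_of_lt hua (lt_add_one a)
  have : u ∈ closure (T ∩ {u : ℂ | u.re < a + 1}) := ho.closure_inter ⟨hu, hlt⟩
  have hsub : T ∩ {u : ℂ | u.re < a + 1} ⊆ T ∩ {u | u.re ≤ a + 1} :=
    fun v hv => ⟨hv.1, (show v.re < a + 1 from hv.2).le⟩
  exact closure_mono hsub this

theorem exists_tract_of_mem_closure {z : ℂ} (hz : z ∈ closure 𝒯) :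
    ∃ T, IsTract 𝒯 T ∧ z ∈ closure T := by
  have hfin := hF.finite_tracts (Metric.isBounded_ball (x := z) (r := 1))
  have h1 : z ∈ closure (𝒯 ∩ Metric.ball z 1) :=
    Metric.isOpen_ball.closure_inter ⟨hz, Metric.mem_ball_self one_pos⟩
  have h2 : 𝒯 ∩ Metric.ball z 1 ⊆ ⋃ T ∈ {T | IsTract 𝒯 T ∧ (T ∩ Metric.ball z 1).Nonempty}, T :=
    fun u hu => mem_iUnion₂.2 ⟨connectedComponentIn 𝒯 u, ⟨⟨u, hu.1, rfl⟩,
      u, mem_connectedComponentIn hu.1, hu.2⟩, mem_connectedComponentIn hu.1⟩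
  have h3 := closure_mono h2 h1
  rw [hfin.closure_biUnion] at h3
  obtain ⟨T, hT, hzT⟩ := mem_iUnion₂.1 h3
  exact ⟨T, hT.1, hzT⟩

/-- Only finitely many other tracts come near `z`, and their closures avoid `z`. -/
theorem eventually_mem_closure_tract (hT : IsTract 𝒯 T) {z : ℂ} (hz : z ∈ closure T) :
    ∀ᶠ u in 𝓝 z, u ∈ closure 𝒯 → u ∈ closure T := by
  have hfin : {T' | (IsTract 𝒯 T' ∧ (T' ∩ Metric.ball z 1).Nonempty) ∧ T' ≠ T}.Finite :=
    (hF.finite_tracts Metric.isBounded_ball).subset fun _ h => h.1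
  have hcl : IsClosed (⋃ T' ∈ {T' | (IsTract 𝒯 T' ∧ (T' ∩ Metric.ball z 1).Nonempty) ∧ T' ≠ T},
    closure T') := hfin.isClosed_biUnion fun _ _ => isClosed_closure
  have hz' : z ∉ ⋃ T' ∈ {T' | (IsTract 𝒯 T' ∧ (T' ∩ Metric.ball z 1).Nonempty) ∧ T' ≠ T},
      closure T' := by
    intro h
    obtain ⟨T', hT', hzT'⟩ := mem_iUnion₂.1 h
    exact disjoint_left.1 (hF.disjoint_closure T' T hT'.1.1 hT hT'.2) hzT' hz
  filter_upwards [hcl.isOpen_compl.mem_nhds hz', Metric.ball_mem_nhds z one_pos] with u hu hub huc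
  obtain ⟨T', hT', huT'⟩ := hF.exists_tract_of_mem_closure huc
  by_cases hTT : T' = T
  · exact hTT ▸ huT'
  · refine absurd (mem_iUnion₂.2 ⟨T', ⟨⟨hT', ?_⟩, hTT⟩, huT'⟩) hu
    rw [inter_comm]
    exact mem_closure_iff.1 huT' _ Metric.isOpen_ball hub

theorem isOpen_image (hT : IsTract 𝒯 T) {V : Set ℂ} (hV : IsOpen V) (hVT : V ⊆ T) :
    IsOpen (F '' V) := by
  obtain ⟨hd, hb⟩ := hF.conformal T hT
  have hj := hF.jordan_tract T hT
  refine ((hd.analyticOnNhd hj.isOpen).is_constant_or_isOpen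
    hj.isConnected.isPreconnected).resolve_left ?_ V hVT hV
  rintro ⟨w, hw⟩
  refine hF.not_bddAbove_re T hT ?_
  obtain ⟨p, hp⟩ := hj.isConnected.nonempty
  refine ⟨p.re, ?_⟩
  rintro _ ⟨q, hq, rfl⟩
  rw [hb.injOn hq hp ((hw q hq).trans (hw p hp).symm)]

theorem exists_inverse (hT : IsTract 𝒯 T) :
    ∃ G : ℂ → ℂ, ContinuousOn G H ∧ MapsTo G H T ∧ ∀ y ∈ H, F (G y) = y := by
  obtain ⟨-, hb⟩ := hF.conformal T hT
  have hright : ∀ y ∈ H, F (Function.invFunOn F T y) = y := fun y hy =>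
    Function.invFunOn_eq (hb.surjOn hy)
  have hmaps : MapsTo (Function.invFunOn F T) H T := fun y hy =>
    Function.invFunOn_mem (hb.surjOn hy)
  refine ⟨Function.invFunOn F T, ?_, hmaps, hright⟩
  intro y hy
  rw [ContinuousWithinAt, tendsto_nhds]
  intro V hV hyV
  have ho := hF.isOpen_image hT (hV.inter (hF.jordan_tract T hT).isOpen) inter_subset_right
  filter_upwards [nhdsWithin_le_nhds (ho.mem_nhds ⟨_, ⟨hyV, hmaps hy⟩, hright y hy⟩),
    self_mem_nhdsWithin] with y' hy' hy'H
  obtain ⟨u, hu, rfl⟩ := hy'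
  have : Function.invFunOn F T (F u) = u := hb.injOn (hmaps hy'H) hu.2 (hright _ hy'H)
  exact (mem_preimage.2 (this.symm ▸ hu.1))

/-- If a boundary point `u` had the same image as some `q ∈ T`, points of `T` near `u` would share
their images with points near `q`, by openness of `F`, against injectivity. -/
theorem mem_tract_of_map_mem (hT : IsTract 𝒯 T) {u : ℂ} (hu : u ∈ closure T) (hFu : F u ∈ H) :
    u ∈ T := by
  by_contra huT
  obtain ⟨-, hb⟩ := hF.conformal T hT
  obtain ⟨q, hq, hqu⟩ := hb.surjOn hFu
  obtain ⟨V, W, hV, hW, hqV, huW, hVW⟩ := t2_separation (show q ≠ u from fun h => huT (h ▸ hq))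
  have ho := hF.isOpen_image hT (hV.inter (hF.jordan_tract T hT).isOpen) inter_subset_right
  have hc : ContinuousWithinAt F T u :=
    (hF.continuousOn_closure u (hT.closure_subset hu)).mono
      (subset_closure.trans (hT.closure_subset))
  have hne : (𝓝[T] u).NeBot := mem_closure_iff_nhdsWithin_neBot.1 hu
  obtain ⟨p, hp1, hpW, hpT⟩ := ((hc.eventually (ho.mem_nhds ⟨q, ⟨hqV, hq⟩, hqu⟩)).and
    (inter_mem (nhdsWithin_le_nhds (hW.mem_nhds huW)) self_mem_nhdsWithin)).exists
  obtain ⟨v, hv, hvp⟩ := hp1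
  rw [hb.injOn hv.2 hpT hvp] at hv
  exact disjoint_left.1 hVW hv.1 hpW

end IsBLog

end LogCoord

/-! ### Orbits along an address and construction of the ray tail -/

namespace LogCoord

variable {H 𝒯 : Set ℂ} {F : ℂ → ℂ} {φ : ℝ → ℝ} {s : ℕ → Set ℂ} {z : ℂ}

/-- The points whose first `N + 1` iterates lie in the prescribed sets `A 0, …, A N`. -/
def orbitSet (F : ℂ → ℂ) (A : ℕ → Set ℂ) (N : ℕ) : Set ℂ :=
  {u | ∀ j ≤ N, F^[j] u ∈ A j}

theorem antitone_orbitSet (A : ℕ → Set ℂ) : Antitone (orbitSet F A) :=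
  fun _ _ hnm _ hu j hj => hu j (hj.trans hnm)

theorem orbitSet_succ (A : ℕ → Set ℂ) (N : ℕ) :
    orbitSet F A (N + 1) = A 0 ∩ F ⁻¹' orbitSet F (fun n => A (n + 1)) N := by
  ext u
  constructor
  · exact fun hu => ⟨hu 0 (Nat.zero_le _), fun j hj => hu (j + 1) (Nat.succ_le_succ hj)⟩
  · rintro ⟨h0, hu⟩ j hj
    cases j with
    | zero => exact h0
    | succ j => exact hu j (Nat.le_of_succ_le_succ hj)

theorem isClosed_orbitSet {B : Set ℂ} (hF : ContinuousOn F B) {A : ℕ → Set ℂ}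
    (hA : ∀ n, IsClosed (A n)) (hAB : ∀ n, A n ⊆ B) (N : ℕ) : IsClosed (orbitSet F A N) := by
  induction N generalizing A with
  | zero =>
    have : orbitSet F A 0 = A 0 := by
      ext u
      exact ⟨fun hu => hu 0 le_rfl, fun hu j hj => by rw [Nat.le_zero.1 hj]; exact hu⟩
    exact this ▸ hA 0
  | succ N ih =>
    rw [orbitSet_succ]
    exact (hF.mono (hAB 0)).preimage_isClosed_of_isClosed (hA 0)
      (ih (fun n => hA (n + 1)) fun n => hAB (n + 1))

theorem continuousOn_iterate (hF : ContinuousOn F (closure 𝒯)) (n : ℕ) :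
    ContinuousOn F^[n] (juliaSet 𝒯 F) := by
  induction n with
  | zero => exact continuousOn_id
  | succ n ih =>
    rw [Function.iterate_succ']
    exact hF.comp ih fun u hu => hu n

theorem juliaAddress_eq_iInter (hs : IsExternalAddress 𝒯 s) :
    juliaAddress 𝒯 F s = ⋂ N, orbitSet F (fun n => closure (s n)) N := by
  ext u
  constructor
  · exact fun hu => mem_iInter.2 fun N j _ => hu.2 j
  · intro hu
    have h : ∀ n, F^[n] u ∈ closure (s n) := fun n => mem_iInter.1 hu n n le_rfl
    exact ⟨fun n => (hs n).closure_subset (h n), h⟩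

/-- The points of the `n`-th tract that are not behind the `n`-th iterate of `z` by a head start. -/
def notBehind (F : ℂ → ℂ) (φ : ℝ → ℝ) (s : ℕ → Set ℂ) (z : ℂ) (n : ℕ) : Set ℂ :=
  closure (s n) ∩ {v | (F^[n] z).re ≤ φ v.re}

theorem isClosed_notBehind (hφ : Continuous φ) (n : ℕ) : IsClosed (notBehind F φ s z n) :=
  isClosed_closure.inter (isClosed_le continuous_const (hφ.comp Complex.continuous_re))

/-- This keeps the sets inside `H`, where inverse branches are defined and continuous. -/
theorem notBehind_subset (hmono : Monotone φ) {R : ℝ} (hR : {z : ℂ | R < z.re} ⊆ H) {n : ℕ}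
    (hz : φ R < (F^[n] z).re) : notBehind F φ s z n ⊆ H := fun v hv => by
  refine hR (show R < v.re from ?_)
  by_contra! h
  exact absurd (hz.trans_le hv.2) (not_lt.2 (hmono h))

namespace IsBLog

variable (hF : IsBLog H 𝒯 F)
include hF

theorem isClosed_juliaAddress (hs : IsExternalAddress 𝒯 s) : IsClosed (juliaAddress 𝒯 F s) := by
  rw [juliaAddress_eq_iInter hs]
  exact isClosed_iInter fun N => isClosed_orbitSet hF.continuousOn_closure
    (fun n => isClosed_closure) (fun n => (hs n).closure_subset) N

theorem not_isCompact_closure_tract {T : Set ℂ} (hT : IsTract 𝒯 T) : ¬ IsCompact (closure T) :=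
  fun h => hF.not_bddAbove_re T hT
    ((h.image Complex.continuous_re).bddAbove.mono (image_mono subset_closure))

/-- At the last level, boundary bumping is applied on the line `re = φ (re z)`. Each induction step
pulls back by the inverse branch into `s 0`; the contrapositive of the head-start condition carries
both bounds, not behind and not ahead, one step back in time. -/
theorem exists_reachesInfinity_orbitSet (hmono : Monotone φ) (hφ : Continuous φ)
    (hlt : ∀ x, x < φ x) {R : ℝ} (hR : {z : ℂ | R < z.re} ⊆ H) (N : ℕ)
    (hs : IsExternalAddress 𝒯 s) (hpair : ∀ k, PairHeadStart F φ (s k) (s (k + 1)))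
    (hz : ∀ n, F^[n] z ∈ closure (s n)) (hzR : ∀ n, φ R < (F^[n] z).re) :
    ∃ w, ReachesInfinity (orbitSet F (notBehind F φ s z) N) w ∧
      ∀ j ≤ N, (F^[j] w).re ≤ φ (F^[j] z).re := by
  induction N generalizing s z with
  | zero =>
    have hC := (hF.jordan_tract _ (hs 0)).isConnected.isPreconnected.closure
    obtain ⟨w, hw, hr⟩ := exists_reachesInfinity hC isClosed_closure (hz 0) (hlt z.re).le
      (hF.isCompact_closure_tract_inter (hs 0) _) (hF.not_isCompact_closure_tract (hs 0))
    refine ⟨w, hr.mono (isClosed_closure.inter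
      (isClosed_le continuous_const Complex.continuous_re)) fun u hu j hj => ?_, fun j hj => ?_⟩
    · rw [Nat.le_zero.1 hj]
      have h1 : φ z.re ≤ u.re := hu.2
      exact ⟨hu.1, (hlt z.re).le.trans (h1.trans (hlt u.re).le)⟩
    · rw [Nat.le_zero.1 hj]
      exact hw.le
  | succ N ih =>
    obtain ⟨w, hw, hwle⟩ := ih (s := fun n => s (n + 1)) (z := F z) (fun n => hs (n + 1))
      (fun k => hpair (k + 1)) (fun n => hz (n + 1)) fun n => hzR (n + 1)
    set S := orbitSet F (notBehind F φ (fun n => s (n + 1)) (F z)) N with hS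
    have hS0 : ∀ y ∈ S, y ∈ closure (s 1) ∧ (F z).re ≤ φ y.re := fun y hy => hy 0 (Nat.zero_le _)
    have hSH : S ⊆ H := fun y hy =>
      notBehind_subset (F := F) (n := 0) (s := fun n => s (n + 1)) (z := F z) hmono hR (hzR 1) (hS0 y hy)
    have hsucc : orbitSet F (notBehind F φ s z) (N + 1) = notBehind F φ s z 0 ∩ F ⁻¹' S :=
      orbitSet_succ _ N
    obtain ⟨G, hGc, hGm, hFG⟩ := hF.exists_inverse (hs 0)
    have hinj := (hF.conformal _ (hs 0)).2.injOn
    have hGS : MapsTo G S (orbitSet F (notBehind F φ s z) (N + 1)) := by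
      intro y hy
      rw [hsucc]
      have hGy := subset_closure (hGm (hSH hy))
      have hFGy := hFG y (hSH hy)
      refine ⟨⟨hGy, ?_⟩, show F (G y) ∈ S from hFGy.symm ▸ hy⟩
      by_contra hcon
      have := hpair 0 (G y) hGy z (hz 0) (hFGy.symm ▸ (hS0 y hy).1) (hz 1) (not_le.1 hcon)
      rw [hFGy] at this
      exact absurd this (not_lt.2 (hS0 y hy).2)
    have hFGw := hFG w (hSH hw.1)
    refine ⟨G w, ReachesInfinity.of_image (F := F) (G := G) (S := S) (hFGw.symm ▸ hw) (hGS hw.1)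
      (isClosed_orbitSet hF.continuousOn_closure (isClosed_notBehind hφ)
        (fun n => inter_subset_left.trans (hs (n + 1)).closure_subset) N) ?_ ?_ ?_
        (hGc.mono hSH) hGS fun y hy => hFG y (hSH hy), ?_⟩
    · rw [hsucc]
      exact hF.continuousOn_closure.mono fun u hu => (hs 0).closure_subset hu.1.1
    · rw [hsucc]
      exact fun u hu => hu.2
    · rw [hsucc]
      refine hinj.mono fun u hu => hF.mem_tract_of_map_mem (hs 0) hu.1.1 (hSH hu.2)
    · intro j hj
      cases j with
      | zero =>
        by_contra! hcon
        have := hpair 0 z (hz 0) (G w) (subset_closure (hGm (hSH hw.1))) (hz 1)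
          (hFGw.symm ▸ (hS0 w hw.1).1) hcon
        rw [hFGw] at this
        exact absurd this (not_lt.2 (hwle 0 (Nat.zero_le _)))
      | succ j =>
        have := hwle j (Nat.le_of_succ_le_succ hj)
        rw [Function.iterate_succ_apply, Function.iterate_succ_apply, hFGw]
        exact this

/-- The approximating points cluster at some `p`. In the limit neither `p` nor `z` ever has a head
start over the other, so `p = z` by separation. -/
theorem reachesInfinity_juliaAddress (hmono : Monotone φ) (hφ : Continuous φ)
    (hlt : ∀ x, x < φ x) {R : ℝ} (hR : {z : ℂ | R < z.re} ⊆ H) (hs : IsExternalAddress 𝒯 s)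
    (hhs : AddressHeadStart 𝒯 F φ s) (hz : z ∈ juliaAddress 𝒯 F s)
    (hzR : ∀ n, φ R < (F^[n] z).re) : ReachesInfinity (juliaAddress 𝒯 F s) z := by
  choose w hw hwle using fun N => hF.exists_reachesInfinity_orbitSet (s := s) (z := z) hmono hφ hlt
    hR N hs hhs.1 hz.2 hzR
  obtain ⟨p, -, hp⟩ := (hF.isCompact_closure_tract_inter (hs 0)
    (φ z.re)).exists_mapClusterPt_of_frequently (l := atTop) (f := w)
    (Eventually.of_forall fun N =>
      ⟨((hw N).1 0 (Nat.zero_le _)).1, hwle N 0 (Nat.zero_le _)⟩).frequently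
  have hcl := isClosed_orbitSet (F := F) hF.continuousOn_closure
    (isClosed_notBehind (F := F) (s := s) (z := z) hφ)
    (fun n => inter_subset_left.trans (hs n).closure_subset)
  have hreach := ReachesInfinity.iInter (antitone_orbitSet _) hcl hw hp
  have hsub : ⋂ N, orbitSet F (notBehind F φ s z) N ⊆ juliaAddress 𝒯 F s := by
    rw [juliaAddress_eq_iInter hs]
    exact iInter_mono fun N u hu j hj => (hu j hj).1
  have hlower : ∀ n, (F^[n] z).re ≤ φ (F^[n] p).re := fun n =>
    (mem_iInter.1 hreach.1 n n le_rfl).2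
  have hupper : ∀ n, (F^[n] p).re ≤ φ (F^[n] z).re := by
    intro n
    -- Continuity of `F` is known only on `closure 𝒯`, so the bounds pass to the limit through a
    -- closed orbit set rather than by continuity of `F^[n]`.
    have hc := isClosed_orbitSet (F := F) (A := fun j => closure (s j) ∩
      {v | v.re ≤ φ (F^[j] z).re}) hF.continuousOn_closure
      (fun j => isClosed_closure.inter (isClosed_le Complex.continuous_re continuous_const))
      (fun j => inter_subset_left.trans (hs j).closure_subset) n
    by_contra hcon
    obtain ⟨m, hm, hnm⟩ := ((hp.frequently (hc.isOpen_compl.mem_nhds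
      fun h => hcon (h n le_rfl).2)).and_eventually (eventually_ge_atTop n)).exists
    exact hm fun j hj => ⟨((hw m).1 j (hj.trans hnm)).1, hwle m j (hj.trans hnm)⟩
  have hpz : p = z := by
    by_contra hne
    obtain ⟨M, h | h⟩ := hhs.2 p (hsub hreach.1) z hz hne
    · exact absurd h (not_lt.2 (hupper M))
    · exact absurd h (not_lt.2 (hlower M))
  rw [hpz] at hreach
  exact hreach.mono (isClosed_iInter hcl) hsub

theorem tendsto_re_of_tendsto_cocompact {ι : Type*} {l : Filter ι} {T : Set ℂ}
    (hT : IsTract 𝒯 T) {α : ι → ℂ} (hα : Tendsto α l (cocompact ℂ)) (hαT : ∀ i, α i ∈ closure T) :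
    Tendsto (fun i => (α i).re) l atTop := by
  refine tendsto_atTop.2 fun c => ?_
  filter_upwards [hα.eventually (hF.isCompact_closure_tract_inter hT c).compl_mem_cocompact]
    with i hi
  by_contra! h
  exact hi ⟨hαT i, h.le⟩

/-- Wherever `re (F (α i)) ≤ c`, the value `F (α i)` lies in a compact subset of `H`, so the inverse
branch bounds `re (α i)`. -/
theorem tendsto_re_map {ι : Type*} {l : Filter ι} {T T' C : Set ℂ} (hT : IsTract 𝒯 T)
    (hT' : IsTract 𝒯 T') (hC : IsClosed C) (hCH : C ⊆ H) (hCT : C ⊆ closure T') {α : ι → ℂ}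
    (hαT : ∀ i, α i ∈ closure T) (hFα : ∀ i, F (α i) ∈ C)
    (hα : Tendsto (fun i => (α i).re) l atTop) :
    Tendsto (fun i => (F (α i)).re) l atTop := by
  obtain ⟨G, hGc, hGm, hFG⟩ := hF.exists_inverse hT
  refine tendsto_atTop.2 fun c => ?_
  have hQ : IsCompact (C ∩ {u | u.re ≤ c}) := by
    refine (hF.isCompact_closure_tract_inter hT' c).of_isClosed_subset
      (hC.inter (isClosed_le Complex.continuous_re continuous_const)) ?_
    exact inter_subset_inter_left _ hCT
  obtain ⟨b, hb⟩ := ((hQ.image_of_continuousOn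
    (hGc.mono (inter_subset_left.trans hCH))).image Complex.continuous_re).bddAbove
  filter_upwards [hα.eventually_gt_atTop b] with i hi
  by_contra! h
  have hiT := hF.mem_tract_of_map_mem hT (hαT i) (hCH (hFα i))
  have hG : G (F (α i)) = α i := (hF.conformal T hT).2.injOn (hGm (hCH (hFα i))) hiT
    (hFG _ (hCH (hFα i)))
  have := hb ⟨_, ⟨F (α i), ⟨hFα i, h.le⟩, rfl⟩, rfl⟩
  rw [hG] at this
  exact absurd hi (not_lt.2 this)

/-- A connected family in `J(F)` has constant external address. -/
theorem mem_juliaAddress_of_continuous (hs : IsExternalAddress 𝒯 s) {Y : Type*}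
    [TopologicalSpace Y] [PreconnectedSpace Y] {α : Y → ℂ} (hα : Continuous α)
    (hαJ : ∀ t, α t ∈ juliaSet 𝒯 F) {t₀ : Y} (ht₀ : α t₀ ∈ juliaAddress 𝒯 F s) (t : Y) :
    α t ∈ juliaAddress 𝒯 F s := by
  refine ⟨hαJ t, fun n => ?_⟩
  have hc : Continuous fun t => F^[n] (α t) :=
    (continuousOn_iterate hF.continuousOn_closure n).comp_continuous hα hαJ
  have hclopen : IsClopen {t | F^[n] (α t) ∈ closure (s n)} := by
    refine ⟨isClosed_closure.preimage hc, isOpen_iff_mem_nhds.2 fun u hu => ?_⟩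
    filter_upwards [hc.continuousAt.eventually (hF.eventually_mem_closure_tract (hs n) hu)]
      with v hv
    exact hv (hαJ v n)
  exact (hclopen.eq_univ ⟨t₀, ht₀.2 n⟩).symm.subset (mem_univ t)

theorem exists_isRayTail (hmono : Monotone φ) (hφ : Continuous φ)
    (hlt : ∀ x, x < φ x) {R : ℝ} (hR : {z : ℂ | R < z.re} ⊆ H) (hs : IsExternalAddress 𝒯 s)
    (hhs : AddressHeadStart 𝒯 F φ s) (hz : z ∈ juliaAddress 𝒯 F s)
    (hzesc : Tendsto (fun n => (F^[n] z).re) atTop atTop) (hzR : ∀ n, φ R < (F^[n] z).re) :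
    ∃ γ : ℝ≥0 → ℂ, IsRayTail 𝒯 F γ ∧ IsArcToInfinity (juliaSet 𝒯 F) z γ ∧
      ∀ α : ℝ≥0 → ℂ, IsArcToInfinity (juliaSet 𝒯 F) z α → ∃ e : ℝ≥0 ≃o ℝ≥0, α = γ ∘ e := by
  have hreach := hF.reachesInfinity_juliaAddress hmono hφ hlt hR hs hhs hz hzR
  have hJ := hF.isClosed_juliaAddress hs
  set J := juliaAddress 𝒯 F s with hJdef
  set h : ℕ → J → ℝ := fun n x => (F^[n] x).re with hh
  have hcont : ∀ n, Continuous (h n) := fun n => Complex.continuous_re.comp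
    ((continuousOn_iterate hF.continuousOn_closure n).comp_continuous continuous_subtype_val
      fun x => x.2.1)
  have hsys : IsHeadStartSystem φ h :=
    { lt_apply := hlt
      step := fun n x y hxy => by
        simp only [hh, Function.iterate_succ_apply'] at hxy ⊢
        refine hhs.1 n _ (x.2.2 n) _ (y.2.2 n) ?_ ?_ hxy
        · exact Function.iterate_succ_apply' F n _ ▸ x.2.2 (n + 1)
        · exact Function.iterate_succ_apply' F n _ ▸ y.2.2 (n + 1)
      separates := fun x y hxy => by
        obtain ⟨M, hM⟩ := hhs.2 x x.2 y y.2 (fun hxy' => hxy (Subtype.ext hxy'))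
        exact ⟨M, hM.symm⟩ }
  let _ := hsys.linearOrder
  have := hsys.orderClosedTopology hφ hcont
  have hle : ∀ x y : J, x ≤ y → ∀ n, h n x ≤ φ (h n y) := fun x y hxy n =>
    not_lt.1 fun hn => hxy ⟨n, hn⟩
  have hproper : ∀ (D : Set J) (c : ℝ), IsClosed D → (∀ x ∈ D, h 0 x ≤ c) → IsCompact D := by
    intro D c hD hDc
    rw [Subtype.isCompact_iff]
    refine (hF.isCompact_closure_tract_inter (hs 0) c).of_isClosed_subset
      (hJ.isClosedMap_subtype_val _ hD) ?_
    rintro _ ⟨x, hx, rfl⟩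
    exact ⟨x.2.2 0, hDc x hx⟩
  have hIic : ∀ x : J, IsCompact (Iic x) := fun x =>
    hproper _ (φ (h 0 x)) isClosed_Iic fun y hy => hle y x hy 0
  have hsep : ∀ x y : J, x < y → ∃ n, runningSup (h n) x < runningSup (h n) y := by
    rintro x y ⟨n, hn⟩
    refine ⟨n, lt_of_le_of_lt (csSup_le ⟨h n x, x, le_refl x, rfl⟩ ?_)
      (hn.trans_le (le_runningSup hIic (hcont n) le_rfl))⟩
    rintro _ ⟨u, hu, rfl⟩
    exact hle u x hu n
  obtain ⟨γ, hγc, hγm, hγ0, hγr⟩ := exists_strictMono_range_eq_Ici h hIic hcont hsep hproper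
    (z := ⟨z, hz⟩) (by
      intro D hD hDc hzD
      refine hreach.2 (Subtype.val '' D) (by rintro _ ⟨x, -, rfl⟩; exact x.2)
        (Subtype.isCompact_iff.1 hDc) ?_ ⟨_, hzD, rfl⟩
      have : J \ Subtype.val '' D = Subtype.val '' Dᶜ := by
        ext u
        constructor
        · rintro ⟨hu, hn⟩
          exact ⟨⟨u, hu⟩, fun hD => hn ⟨_, hD, rfl⟩, rfl⟩
        · rintro ⟨x, hx, rfl⟩
          refine ⟨x.2, ?_⟩
          rintro ⟨y, hy, hyx⟩
          exact hx (Subtype.ext hyx ▸ hy)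
      rw [this]
      exact hJ.isClosedMap_subtype_val _ hD.compl.isClosed)
  have hzγ : ∀ t n, (F^[n] z).re ≤ φ (h n (γ t)) := fun t n =>
    hle ⟨z, hz⟩ (γ t) (hγr.subset ⟨t, rfl⟩) n
  have hunif : ∀ M : ℝ, ∃ N : ℕ, ∀ n ≥ N, ∀ t, M ≤ h n (γ t) := by
    intro M
    obtain ⟨N, hN⟩ := eventually_atTop.1 (hzesc.eventually_gt_atTop (φ M))
    refine ⟨N, fun n hn t => ?_⟩
    by_contra! hcon
    exact absurd ((hN n hn).trans_le (hzγ t n)) (not_lt.2 (hmono hcon.le))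
  have hre : ∀ n, Tendsto (fun t => h n (γ t)) atTop atTop := by
    intro n
    induction n with
    | zero =>
      refine tendsto_atTop.2 fun M => ?_
      -- Otherwise the range of `γ` is compact and has a greatest element, impossible for a strictly
      -- increasing curve.
      have : ∃ t, φ M < h 0 (γ t) := by
        by_contra! hcon
        have hcomp : IsCompact (range γ) := hproper _ (φ M) (hγr ▸ isClosed_Ici) (by
          rintro _ ⟨t, rfl⟩
          exact hcon t)
        obtain ⟨_, ⟨t, rfl⟩, ht⟩ := hcomp.exists_isGreatest (range_nonempty γ)
        exact absurd (ht ⟨t + 1, rfl⟩) (not_le.2 (hγm (lt_add_one t)))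
      obtain ⟨t₀, ht₀⟩ := this
      filter_upwards [eventually_ge_atTop t₀] with t ht
      by_contra! hcon
      exact absurd (ht₀.trans_le (hle _ _ (hγm.monotone ht) 0)) (not_lt.2 (hmono hcon.le))
    | succ n ih =>
      have := hF.tendsto_re_map (hs n) (hs (n + 1)) (C := notBehind F φ s z (n + 1))
        (isClosed_notBehind hφ _) (notBehind_subset hmono hR (hzR _)) inter_subset_left
        (α := fun t => F^[n] (γ t)) (fun t => (γ t).2.2 n) (fun t => by
          rw [← Function.iterate_succ_apply' F]
          exact ⟨(γ t).2.2 (n + 1), hzγ t (n + 1)⟩) ih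
      simpa only [hh, Function.iterate_succ_apply'] using this
  refine ⟨fun t => γ t, ⟨continuous_subtype_val.comp hγc, Subtype.val_injective.comp hγm.injective,
    fun t => ⟨(γ t).2.1, tendsto_atTop.2 fun M => ?_⟩, hre, hunif⟩,
    ⟨continuous_subtype_val.comp hγc, Subtype.val_injective.comp hγm.injective,
      fun t => (γ t).2.1, congrArg Subtype.val hγ0, ?_⟩, fun α hα => ?_⟩
  · obtain ⟨N, hN⟩ := hunif M
    exact eventually_atTop.2 ⟨N, fun n hn => hN n hn t⟩
  · rw [← Metric.cobounded_eq_cocompact, ← tendsto_norm_atTop_iff_cobounded]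
    exact tendsto_atTop_mono (fun t => Complex.re_le_norm _) (hre 0)
  · have hαJ : ∀ t, α t ∈ J := hF.mem_juliaAddress_of_continuous hs hα.continuous hα.mem
      (t₀ := 0) (hα.start.symm ▸ hz)
    have hαre := hF.tendsto_re_of_tendsto_cocompact (hs 0) hα.tendsto_infty
      fun t => (hαJ t).2 0
    obtain ⟨e, he⟩ := exists_orderIso_of_injective (α := fun t => (⟨α t, hαJ t⟩ : J)) hγm
      (hγ0.symm ▸ hγr) (hα.continuous.subtype_mk _)
      (fun a b hab => hα.injective (congrArg Subtype.val hab))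
      (by rw [hγ0]; exact Subtype.ext hα.start) fun t => by
        obtain ⟨u, hu⟩ := (hαre.eventually_gt_atTop (φ (h 0 (γ t)))).exists
        exact ⟨u, 0, hu⟩
    exact ⟨e, funext fun t => congrArg Subtype.val (congrFun he t)⟩

end IsBLog

/-- The time `k` is chosen from the function `φ` of the full address, while separation on the
shifted address is available only for a function `ψ` depending on `k`. The minimum keeps the
separation of `ψ`, and its value at `R` is at most `φ R`, so `k` still works. -/
theorem AddressHeadStart.min {ψ : ℝ → ℝ} (hφ : ∀ k, PairHeadStart F φ (s k) (s (k + 1)))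
    (hψ : AddressHeadStart 𝒯 F ψ s) : AddressHeadStart 𝒯 F (fun x => min (φ x) (ψ x)) s := by
  refine ⟨fun k z hz w hw hFz hFw h => ?_, fun z hz w hw hne => ?_⟩
  · rcases min_lt_iff.1 h with h | h
    · exact min_lt_iff.2 (Or.inl (hφ k z hz w hw hFz hFw h))
    · exact min_lt_iff.2 (Or.inr (hψ.1 k z hz w hw hFz hFw h))
  · obtain ⟨M, hM⟩ := hψ.2 z hz w hw hne
    exact ⟨M, hM.imp (fun h => min_lt_iff.2 (Or.inr h)) fun h => min_lt_iff.2 (Or.inr h)⟩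

end LogCoord

theorem theorem4p2 (H 𝒯 : Set ℂ) (F : ℂ → ℂ) (hF : IsBLog H 𝒯 F) (hs : HeadStart 𝒯 F)
    (z : ℂ) (hz : z ∈ escapingSet 𝒯 F) :
    ∃ (k : ℕ) (γ : ℝ≥0 → ℂ), IsRayTail 𝒯 F γ ∧
      IsArcToInfinity (juliaSet 𝒯 F) (F^[k] z) γ ∧
      ∀ α : ℝ≥0 → ℂ, IsArcToInfinity (juliaSet 𝒯 F) (F^[k] z) α →
        ∃ h : ℝ≥0 ≃o ℝ≥0, α = γ ∘ h := by
  choose s hst hsz using fun n => hF.exists_tract_of_mem_closure (hz.1 n)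
  obtain ⟨R, hR⟩ := hF.halfPlane_subset
  obtain ⟨φ, hφm, hφc, hφlt, hφh⟩ := hs s hst
  obtain ⟨k, hk⟩ := eventually_atTop.1 (hz.2.eventually_gt_atTop (φ R))
  obtain ⟨ψ, hψm, hψc, hψlt, hψh⟩ := hs (fun n => s (n + k)) fun n => hst (n + k)
  have hit : ∀ n, F^[n] (F^[k] z) = F^[n + k] z := fun n =>
    (Function.iterate_add_apply F n k z).symm
  refine ⟨k, hF.exists_isRayTail (φ := fun x => min (φ x) (ψ x)) (hφm.min hψm) (hφc.min hψc)
    (fun x => lt_min (hφlt x) (hψlt x)) hR (fun n => hst (n + k)) (AddressHeadStart.min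
      (fun j => by simpa only [Nat.add_right_comm] using hφh.1 (j + k)) hψh)
    ⟨fun n => hit n ▸ hz.1 (n + k), fun n => hit n ▸ hsz (n + k)⟩ ?_ fun n => ?_⟩
  · simp only [hit]
    exact (tendsto_add_atTop_iff_nat (f := fun n => (F^[n] z).re) k).2 hz.2
  · rw [hit]
    exact (min_le_left _ _).trans_lt (hk (n + k) (Nat.le_add_left k n))
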